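/- Let $E$ be a semilattice, i.e. a commutative idempotent semigroup, ordered by $e\le f\iff e=ef$. A Fell bundle $\mathcal E$ over $E$ consists of complex Banach spaces $A_e$ ($e\in E$), bilinear products $A_e\times A_f\to A_{ef}$, $(a,b)\mapsto a\cdot b$, conjugate-linear isometries $a\mapsto a^*$ of $A_e$ into itself, and linear isometries $j_{f,e}:A_e\to A_f$ for $e\le f$, such that $(a\cdot b)\cdot c=a\cdot(b\cdot c)$, $(a\cdot b)^*=b^*\cdot a^*$, $a^{**}=a$, $\|a\cdot b\|\le\|a\|\,\|b\|$, $\|a^*\cdot a\|=\|a\|^2$, $j_{g,e}=j_{g,f}\circ j_{f,e}$ for $e\le f\le g$, $j_{e'f',ef}(a\cdot b)=j_{e',e}(a)\cdot j_{f',f}(b)$ for $e\le e'$, $f\le f'$, $a\in A_e$, $b\in A_f$, and $j_{f,e}(a^*)=j_{f,e}(a)^*$. Each $A_e$ is then a $C^*$-algebra, and $a^*\cdot a\ge 0$ in $A_e$ for all $a\in A_e$. Let $C_c(\mathcal E)=\bigoplus_{e\in E}A_e$ be the $*$-algebra of finite sums $\sum_e a_e\delta_e$ with $(a_e\delta_e)(b_f\delta_f)=(a_e\cdot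 b_f)\delta_{ef}$ and $(a_e\delta_e)^*=a_e^*\delta_e$. The full algebra $C^*_{\rm KS}(\mathcal E)$ is the completion of $C_c(\mathcal E)$ with respect to $\|g\|_{\rm u}=\sup_\Phi\|\Phi(g)\|$, the supremum being over all $*$-homomorphisms $\Phi$ from $C_c(\mathcal E)$ into $C^*$-algebras. For $e\in E$ let $\mathcal L(A_e)$ be the $C^*$-algebra of adjointable operators on $A_e$, viewed as a right Hilbert module over itself. The left regular representation is the $*$-homomorphism $$\Phi_\Lambda: C_c(\mathcal E)\to\prod_{e\in E}\mathcal L(A_e),\qquad \Phi_\Lambda\Big(\sum_f a_f\delta_f\Big)=\Big(\sum_f\lambda_{e,f}(a_f)\Big)_{e\in E},$$ where the product consists of the bounded families with the supremum norm and, for $b\in A_e$, $\lambda_{e,f}(a_f)b=a_f\cdot b$ if $e\le f$ and $\lambda_{e,f}(a_f)b=0$ otherwise. The reduced algebra $C^*_{\rm r,KS}(\mathcal E)$ is the completion of $C_c(\mathcal E)$ with respect to $\|g\|_{\rm r}=\|\Phi_\Lambda(g)\|$. Then $C^*_{\rm r,KS}(\mathcal E)=C^*_{\rm KS}(\mathcal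 E)$. That is, $\|g\|_{\rm r}=\|g\|_{\rm u}$ for all $g\in C_c(\mathcal E)$; equivalently, $\|\Phi(g)\|\le\|\Phi_\Lambda(g)\|$ for every $*$-homomorphism $\Phi$ from $C_c(\mathcal E)$ into a $C^*$-algebra and every $g\in C_c(\mathcal E)$; and there is an isometric $*$-isomorphism from $C^*_{\rm KS}(\mathcal E)$ onto $C^*_{\rm r,KS}(\mathcal E)$ that maps the canonical image of each $g\in C_c(\mathcal E)$ to the canonical image of $g$. -/

import Mathlib

open scoped ENNReal
open DirectSum

universe u v w

noncomputable section

/-! ## Completion of a complex `*`-algebra in a `C*`-seminorm -/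

/-- A `C*`-seminorm on a complex `*`-algebra. -/
structure CStarSeminorm (A : Type u) [NonUnitalRing A] [StarRing A] [Module ℂ A]
    extends Seminorm ℂ A where
  mul_le' : ∀ a b : A, toFun (a * b) ≤ toFun a * toFun b
  star_mul_self' : ∀ a : A, toFun (star a * a) = toFun a ^ 2

namespace CStarSeminorm

variable {A : Type u} [NonUnitalRing A] [StarRing A] [Module ℂ A]

instance : CoeFun (CStarSeminorm A) (fun _ => A → ℝ) := ⟨fun p => p.toSeminorm⟩

/-- The seminorm obtained by pulling back the norm of a `C*`-algebra along a `*`-homomorphism. -/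
def ofHom {B : Type v} [NonUnitalCStarAlgebra B] (φ : A →⋆ₙₐ[ℂ] B) : CStarSeminorm A where
  toFun a := ‖φ a‖
  map_zero' := by simp
  add_le' a b := by rw [map_add]; exact norm_add_le _ _
  neg' a := by rw [map_neg, norm_neg]
  smul' c a := by rw [map_smul, norm_smul]
  mul_le' a b := by rw [map_mul]; exact norm_mul_le _ _
  star_mul_self' a := by rw [map_mul, map_star, CStarRing.norm_star_mul_self, sq]

/-- `A` itself, regarded as a seminormed space through `p`. -/
def Pre (_ : CStarSeminorm A) : Type u := A

variable (p : CStarSeminorm A)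

instance : NonUnitalRing p.Pre := inferInstanceAs (NonUnitalRing A)
instance : StarRing p.Pre := inferInstanceAs (StarRing A)
instance : Module ℂ p.Pre := inferInstanceAs (Module ℂ A)

instance : NonUnitalSeminormedRing p.Pre where
  __ := (inferInstance : NonUnitalRing p.Pre)
  __ := p.toSeminorm.toAddGroupSeminorm.toSeminormedAddCommGroup
  norm_mul_le := p.mul_le'

lemma norm_pre (a : p.Pre) : ‖a‖ = p.toSeminorm a := rfl

instance : NormedSpace ℂ p.Pre where
  norm_smul_le c a := (p.toSeminorm.smul' c a).le

lemma pre_norm_star_mul_self (a : p.Pre) : ‖star a * a‖ = ‖a‖ ^ 2 := p.star_mul_self' a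

lemma pre_norm_le_star (a : p.Pre) : ‖a‖ ≤ ‖star a‖ := by
  have h := (p.pre_norm_star_mul_self a).symm.le.trans (norm_mul_le _ _)
  by_contra! hlt
  nlinarith [norm_nonneg a, norm_nonneg (star a)]

instance : NormedStarGroup p.Pre where
  norm_star_le a := by simpa using p.pre_norm_le_star (star a)

/-- The (Hausdorff) completion of `A` in the `C*`-seminorm `p`. -/
def Completion : Type u := UniformSpace.Completion p.Pre

instance : NormedAddCommGroup p.Completion :=
  inferInstanceAs (NormedAddCommGroup (UniformSpace.Completion p.Pre))
instance : NormedSpace ℂ p.Completion :=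
  inferInstanceAs (NormedSpace ℂ (UniformSpace.Completion p.Pre))
instance : CompleteSpace p.Completion :=
  inferInstanceAs (CompleteSpace (UniformSpace.Completion p.Pre))

/-- The canonical map from `A` to its completion. -/
def toCompletion (a : A) : p.Completion := ((show p.Pre from a : p.Pre) : UniformSpace.Completion p.Pre)

lemma isDenseInducing_toCompletion :
    IsDenseInducing (fun a : p.Pre => (p.toCompletion a : p.Completion)) :=
  UniformSpace.Completion.isDenseInducing_coe

lemma continuous_toCompletion :
    Continuous (fun a : p.Pre => (p.toCompletion a : p.Completion)) :=
  UniformSpace.Completion.continuous_coe _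

lemma toCompletion_add (a b : A) :
    p.toCompletion (a + b) = p.toCompletion a + p.toCompletion b :=
  UniformSpace.Completion.coe_add (α := p.Pre) a b

lemma toCompletion_zero : p.toCompletion 0 = 0 :=
  UniformSpace.Completion.coe_zero (α := p.Pre)

lemma toCompletion_smul (c : ℂ) (a : A) :
    p.toCompletion (c • a) = c • p.toCompletion a :=
  UniformSpace.Completion.coe_smul (X := p.Pre) c a

lemma norm_toCompletion (a : A) : ‖p.toCompletion a‖ = p a :=
  UniformSpace.Completion.norm_coe (E := p.Pre) a

/-- The product on the completion is the continuous extension of the product of `A`. -/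
instance : Mul p.Completion :=
  ⟨Function.curry <| (p.isDenseInducing_toCompletion.prodMap p.isDenseInducing_toCompletion).extend
    (fun x : p.Pre × p.Pre => p.toCompletion (x.1 * x.2 : p.Pre))⟩

/-- The involution on the completion is the continuous extension of the involution of `A`. -/
instance : Star p.Completion :=
  ⟨UniformSpace.Completion.map (star : p.Pre → p.Pre)⟩

lemma uniformContinuous_pre_star : UniformContinuous (star : p.Pre → p.Pre) :=
  (starNormedAddGroupHom (E := p.Pre)).uniformContinuous

lemma toCompletion_mul (a b : A) :
    p.toCompletion (a * b) = p.toCompletion a * p.toCompletion b :=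
  ((p.isDenseInducing_toCompletion.prodMap p.isDenseInducing_toCompletion).extend_eq
    (p.continuous_toCompletion.comp (continuous_mul (M := p.Pre))) (a, b)).symm

lemma toCompletion_star (a : A) : p.toCompletion (star a) = star (p.toCompletion a) :=
  (UniformSpace.Completion.map_coe p.uniformContinuous_pre_star a).symm

instance : ContinuousMul p.Completion where
  continuous_mul := by
    let m := (AddMonoidHom.mul : p.Pre →+ p.Pre →+ p.Pre).compr₂
      (UniformSpace.Completion.toCompl (α := p.Pre))
    have : Continuous fun q : p.Pre × p.Pre => m q.1 q.2 :=
      (UniformSpace.Completion.continuous_coe p.Pre).comp continuous_mul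
    have di : IsDenseInducing (UniformSpace.Completion.toCompl : p.Pre → _) :=
      UniformSpace.Completion.isDenseInducing_coe
    exact (di.extend_Z_bilin di this :)

instance : ContinuousStar p.Completion where
  continuous_star := UniformSpace.Completion.continuous_map (f := (star : p.Pre → p.Pre))

@[elab_as_elim]
lemma completion_induction {P : p.Completion → Prop} (x : p.Completion)
    (hc : IsClosed {x | P x}) (h : ∀ a : A, P (p.toCompletion a)) : P x :=
  UniformSpace.Completion.induction_on (α := p.Pre) x hc h

lemma completion_zero_mul (x : p.Completion) : 0 * x = 0 := by
  refine p.completion_induction x (isClosed_eq (by fun_prop) (by fun_prop)) fun a => ?_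
  rw [← toCompletion_zero, ← toCompletion_mul, zero_mul]

lemma completion_mul_zero (x : p.Completion) : x * 0 = 0 := by
  refine p.completion_induction x (isClosed_eq (by fun_prop) (by fun_prop)) fun a => ?_
  rw [← toCompletion_zero, ← toCompletion_mul, mul_zero]

lemma completion_mul_assoc (x y z : p.Completion) : x * y * z = x * (y * z) := by
  refine p.completion_induction x (isClosed_eq ((continuous_id.mul continuous_const).mul
    continuous_const) (continuous_id.mul continuous_const)) fun a => ?_
  refine p.completion_induction y (isClosed_eq ((continuous_const.mul continuous_id).mul
    continuous_const) (continuous_const.mul (continuous_id.mul continuous_const))) fun b => ?_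
  refine p.completion_induction z (isClosed_eq (continuous_const.mul continuous_id)
    (continuous_const.mul (continuous_const.mul continuous_id))) fun c => ?_
  simp only [← toCompletion_mul, mul_assoc]

lemma completion_mul_add (x y z : p.Completion) : x * (y + z) = x * y + x * z := by
  refine p.completion_induction x (isClosed_eq (by fun_prop) (by fun_prop)) fun a => ?_
  refine p.completion_induction y (isClosed_eq (by fun_prop) (by fun_prop)) fun b => ?_
  refine p.completion_induction z (isClosed_eq (by fun_prop) (by fun_prop)) fun c => ?_
  simp only [← toCompletion_mul, ← toCompletion_add, mul_add]

lemma completion_add_mul (x y z : p.Completion) : (x + y) * z = x * z + y * z := by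
  refine p.completion_induction x (isClosed_eq (by fun_prop) (by fun_prop)) fun a => ?_
  refine p.completion_induction y (isClosed_eq (by fun_prop) (by fun_prop)) fun b => ?_
  refine p.completion_induction z (isClosed_eq (by fun_prop) (by fun_prop)) fun c => ?_
  simp only [← toCompletion_mul, ← toCompletion_add, add_mul]

lemma completion_norm_mul_le (x y : p.Completion) : ‖x * y‖ ≤ ‖x‖ * ‖y‖ := by
  refine p.completion_induction x (isClosed_le (by fun_prop) (by fun_prop)) fun a => ?_
  refine p.completion_induction y (isClosed_le (by fun_prop) (by fun_prop)) fun b => ?_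
  rw [← toCompletion_mul]
  simp only [norm_toCompletion]
  exact p.mul_le' a b

instance : NonUnitalNormedRing p.Completion :=
  { (inferInstance : NormedAddCommGroup p.Completion) with
    mul := (· * ·)
    zero_mul := p.completion_zero_mul
    mul_zero := p.completion_mul_zero
    mul_assoc := p.completion_mul_assoc
    left_distrib := p.completion_mul_add
    right_distrib := p.completion_add_mul
    norm_mul_le := p.completion_norm_mul_le }

instance : StarRing p.Completion where
  star_involutive x := by
    refine p.completion_induction x (isClosed_eq (by fun_prop) (by fun_prop)) fun a => ?_
    simp only [← toCompletion_star, star_star]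
  star_mul x y := by
    refine p.completion_induction x (isClosed_eq (by fun_prop) (by fun_prop)) fun a => ?_
    refine p.completion_induction y (isClosed_eq (by fun_prop) (by fun_prop)) fun b => ?_
    simp only [← toCompletion_star, ← toCompletion_mul, star_mul]
  star_add x y := by
    refine p.completion_induction x (isClosed_eq (by fun_prop) (by fun_prop)) fun a => ?_
    refine p.completion_induction y (isClosed_eq (by fun_prop) (by fun_prop)) fun b => ?_
    simp only [← toCompletion_star, ← toCompletion_add, star_add]

instance : CStarRing p.Completion where
  norm_mul_self_le x := by
    refine p.completion_induction x (isClosed_le (by fun_prop) (by fun_prop)) fun a => ?_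
    rw [← toCompletion_star, ← toCompletion_mul]
    simp only [norm_toCompletion]
    exact ((p.star_mul_self' a).trans (sq _)).ge

lemma completion_smul_mul [IsScalarTower ℂ A A] (c : ℂ) (x y : p.Completion) :
    c • x * y = c • (x * y) := by
  refine p.completion_induction x (isClosed_eq ((continuous_id.const_smul c).mul continuous_const)
    ((continuous_id.mul continuous_const).const_smul c)) fun a => ?_
  refine p.completion_induction y (isClosed_eq (continuous_const.mul continuous_id)
    ((continuous_const.mul continuous_id).const_smul c)) fun b => ?_
  simp only [← toCompletion_smul, ← toCompletion_mul, smul_mul_assoc]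

lemma completion_mul_smul [SMulCommClass ℂ A A] (c : ℂ) (x y : p.Completion) :
    c • (x * y) = x * c • y := by
  refine p.completion_induction x (isClosed_eq ((continuous_id.mul continuous_const).const_smul c)
    (continuous_id.mul continuous_const)) fun a => ?_
  refine p.completion_induction y (isClosed_eq ((continuous_const.mul continuous_id).const_smul c)
    (continuous_const.mul (continuous_id.const_smul c))) fun b => ?_
  simp only [← toCompletion_smul, ← toCompletion_mul, mul_smul_comm]

lemma completion_star_smul [StarModule ℂ A] (c : ℂ) (x : p.Completion) :
    star (c • x) = star c • star x := by
  refine p.completion_induction x (isClosed_eq (continuous_star.comp (continuous_id.const_smul c))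
    (continuous_id.star.const_smul (star c))) fun a => ?_
  simp only [← toCompletion_smul, ← toCompletion_star, star_smul]

instance [IsScalarTower ℂ A A] [SMulCommClass ℂ A A] [StarModule ℂ A] :
    NonUnitalCStarAlgebra p.Completion where
  __ := (inferInstance : CompleteSpace p.Completion)
  __ := (inferInstance : NormedSpace ℂ p.Completion)
  smul_assoc := p.completion_smul_mul
  smul_comm := p.completion_mul_smul
  star_smul := p.completion_star_smul

end CStarSeminorm

/-! ## Fell bundles over a semilattice -/

/-- A Fell bundle over a semilattice `E`, the product of `E` being the meet `⊓`.  It consists of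
complex Banach spaces `A e` (`fiber e`), bilinear products `A e × A f → A (e ⊓ f)`, conjugate
linear isometries `A e → A e` (each `e` is its own inverse in `E`), and isometric linear maps
`A e → A f` for `e ≤ f`.  Identities between elements of the fibers over two a priori
different expressions of the same index are written as identities in the disjoint union of the
fibers.

The requirement that `a* · a` be positive in the `C*`-algebra `A e` for `a ∈ A e` needs no field:
for a semilattice it asks that the product of `a*` and `a` in `A e` be positive in `A e`. -/
structure FellBundle (E : Type u) [SemilatticeInf E] where
  fiber : E → Type v
  [normedAddCommGroup : ∀ e, NormedAddCommGroup (fiber e)]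
  [normedSpace : ∀ e, NormedSpace ℂ (fiber e)]
  [completeSpace : ∀ e, CompleteSpace (fiber e)]
  prod : ∀ e f, fiber e →ₗ[ℂ] fiber f →ₗ[ℂ] fiber (e ⊓ f)
  inv : ∀ e, fiber e →ₗᵢ⋆[ℂ] fiber e
  incl : ∀ {e f}, e ≤ f → fiber e →ₗᵢ[ℂ] fiber f
  prod_assoc : ∀ {e f g} (a : fiber e) (b : fiber f) (c : fiber g),
    (⟨_, prod _ _ (prod _ _ a b) c⟩ : Σ e, fiber e) = ⟨_, prod _ _ a (prod _ _ b c)⟩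
  inv_prod : ∀ {e f} (a : fiber e) (b : fiber f),
    (⟨_, inv _ (prod _ _ a b)⟩ : Σ e, fiber e) = ⟨_, prod _ _ (inv _ b) (inv _ a)⟩
  inv_inv : ∀ {e} (a : fiber e), inv e (inv e a) = a
  norm_prod_le : ∀ {e f} (a : fiber e) (b : fiber f), ‖prod _ _ a b‖ ≤ ‖a‖ * ‖b‖
  norm_inv_prod_self : ∀ {e} (a : fiber e), ‖prod _ _ (inv _ a) a‖ = ‖a‖ ^ 2
  incl_incl : ∀ {e f g} (h : e ≤ f) (h' : f ≤ g) (a : fiber e),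
    incl (h.trans h') a = incl h' (incl h a)
  incl_prod : ∀ {e e' f f'} (h : e ≤ e') (h' : f ≤ f') (a : fiber e) (b : fiber f),
    incl (inf_le_inf h h') (prod _ _ a b) = prod _ _ (incl h a) (incl h' b)
  incl_inv : ∀ {e f} (h : e ≤ f) (a : fiber e), incl h (inv _ a) = inv _ (incl h a)

namespace FellBundle

attribute [instance] normedAddCommGroup normedSpace completeSpace

variable {E : Type u} [SemilatticeInf E] (𝓔 : FellBundle.{u, v} E)

/-- The identification of the fibers over two equal indices. -/
def transport {e f : E} (h : e = f) : 𝓔.fiber e ≃ₗᵢ[ℂ] 𝓔.fiber f := by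
  subst h
  exact LinearIsometryEquiv.refl ℂ _

variable {𝓔} in
lemma mk_transport {e f : E} (h : e = f) (a : 𝓔.fiber e) :
    (⟨f, 𝓔.transport h a⟩ : Σ e, 𝓔.fiber e) = ⟨e, a⟩ := by
  subst h
  rfl

variable {𝓔} in
lemma mk_prod_congr {e e' f f' : E} {a : 𝓔.fiber e} {a' : 𝓔.fiber e'} {b : 𝓔.fiber f}
    {b' : 𝓔.fiber f'} (h : (⟨e, a⟩ : Σ e, 𝓔.fiber e) = ⟨e', a'⟩)
    (h' : (⟨f, b⟩ : Σ e, 𝓔.fiber e) = ⟨f', b'⟩) :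
    (⟨_, 𝓔.prod _ _ a b⟩ : Σ e, 𝓔.fiber e) = ⟨_, 𝓔.prod _ _ a' b'⟩ := by
  cases h; cases h'; rfl

variable {𝓔} in
lemma mk_inv_congr {e e' : E} {a : 𝓔.fiber e} {a' : 𝓔.fiber e'}
    (h : (⟨e, a⟩ : Σ e, 𝓔.fiber e) = ⟨e', a'⟩) :
    (⟨_, 𝓔.inv _ a⟩ : Σ e, 𝓔.fiber e) = ⟨_, 𝓔.inv _ a'⟩ := by
  cases h; rfl

/-! ### The fibers are `C*`-algebras -/

instance (e : E) : Mul (𝓔.fiber e) := ⟨fun a b => 𝓔.transport (inf_idem e) (𝓔.prod e e a b)⟩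

instance (e : E) : Star (𝓔.fiber e) := ⟨𝓔.inv e⟩

lemma fiber_mul_def {e : E} (a b : 𝓔.fiber e) :
    a * b = 𝓔.transport (inf_idem e) (𝓔.prod e e a b) := rfl

lemma fiber_star_def {e : E} (a : 𝓔.fiber e) : star a = 𝓔.inv e a := rfl

lemma mk_fiber_mul {e : E} (a b : 𝓔.fiber e) :
    (⟨e, a * b⟩ : Σ e, 𝓔.fiber e) = ⟨_, 𝓔.prod e e a b⟩ := mk_transport _ _

instance (e : E) : NonUnitalNormedRing (𝓔.fiber e) :=
  { 𝓔.normedAddCommGroup e with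
    mul := (· * ·)
    zero_mul := fun a => by simp [fiber_mul_def]
    mul_zero := fun a => by simp [fiber_mul_def]
    left_distrib := fun a b c => by simp [fiber_mul_def]
    right_distrib := fun a b c => by simp [fiber_mul_def]
    mul_assoc := fun a b c => by
      refine sigma_mk_injective (i := e) ?_
      show (⟨e, a * b * c⟩ : Σ e, 𝓔.fiber e) = ⟨e, a * (b * c)⟩
      rw [mk_fiber_mul, mk_fiber_mul, mk_prod_congr (𝓔.mk_fiber_mul a b) rfl, 𝓔.prod_assoc,
        mk_prod_congr rfl (𝓔.mk_fiber_mul b c)]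
    norm_mul_le := fun a b => by
      show ‖𝓔.transport (inf_idem e) (𝓔.prod e e a b)‖ ≤ _
      rw [LinearIsometryEquiv.norm_map]
      exact 𝓔.norm_prod_le a b }

instance (e : E) : NonUnitalCStarAlgebra (𝓔.fiber e) where
  __ := 𝓔.normedSpace e
  __ := 𝓔.completeSpace e
  star_involutive := fun a => 𝓔.inv_inv a
  star_mul := fun a b => by
    refine sigma_mk_injective (i := e) ?_
    show (⟨e, 𝓔.inv e (a * b)⟩ : Σ e, 𝓔.fiber e) = ⟨e, star b * star a⟩
    rw [mk_fiber_mul, mk_inv_congr (𝓔.mk_fiber_mul a b), 𝓔.inv_prod]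
    rfl
  star_add := fun a b => map_add (𝓔.inv e) a b
  star_smul := fun c a => (𝓔.inv e).map_smulₛₗ c a
  norm_mul_self_le := fun a => by
    rw [fiber_mul_def, LinearIsometryEquiv.norm_map, fiber_star_def, 𝓔.norm_inv_prod_self, sq]
  smul_assoc := fun c a b => by simp [fiber_mul_def]
  smul_comm := fun c a b => by simp [fiber_mul_def]

/-! ### The convolution `*`-algebra -/

/-- The space of finitely supported sections, that is, the algebraic direct sum of the fibers. -/
def Sections : Type (max u v) := DirectSum E 𝓔.fiber

instance : AddCommGroup 𝓔.Sections := inferInstanceAs (AddCommGroup (DirectSum E 𝓔.fiber))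
instance : Module ℂ 𝓔.Sections := inferInstanceAs (Module ℂ (DirectSum E 𝓔.fiber))

open Classical in
/-- The section `a δ_e`. -/
def delta (e : E) : 𝓔.fiber e →ₗ[ℂ] 𝓔.Sections := DirectSum.lof ℂ E 𝓔.fiber e

open Classical in
/-- The linear map on sections with given restrictions to the fibers. -/
def lift {M : Type w} [AddCommGroup M] [Module ℂ M] (φ : ∀ e, 𝓔.fiber e →ₗ[ℂ] M) :
    𝓔.Sections →ₗ[ℂ] M := DirectSum.toModule ℂ E M φ

open Classical in
@[simp] lemma lift_delta {M : Type w} [AddCommGroup M] [Module ℂ M]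
    (φ : ∀ e, 𝓔.fiber e →ₗ[ℂ] M) (e : E) (a : 𝓔.fiber e) : 𝓔.lift φ (𝓔.delta e a) = φ e a :=
  DirectSum.toModule_lof ℂ e a

open Classical in
variable {𝓔} in
@[elab_as_elim]
lemma sections_induction {P : 𝓔.Sections → Prop} (g : 𝓔.Sections) (h0 : P 0)
    (h1 : ∀ e a, P (𝓔.delta e a)) (h2 : ∀ x y, P x → P y → P (x + y)) : P g :=
  DirectSum.induction_on (β := 𝓔.fiber) g h0 h1 h2

/-- The convolution product as a bilinear map. -/
def convolution : 𝓔.Sections →ₗ[ℂ] 𝓔.Sections →ₗ[ℂ] 𝓔.Sections :=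
  𝓔.lift fun e => LinearMap.flip <| 𝓔.lift fun f =>
    ((𝓔.prod e f).compr₂ (𝓔.delta (e ⊓ f))).flip

open Classical in
/-- The involution of sections as an additive map. -/
def involution : 𝓔.Sections →+ 𝓔.Sections :=
  DirectSum.toAddMonoid (β := 𝓔.fiber) fun e =>
    ((𝓔.delta e).toAddMonoidHom).comp (𝓔.inv e).toLinearMap.toAddMonoidHom

instance : Mul 𝓔.Sections := ⟨fun g h => 𝓔.convolution g h⟩
instance : Star 𝓔.Sections := ⟨𝓔.involution⟩

lemma sections_mul_def (g h : 𝓔.Sections) : g * h = 𝓔.convolution g h := rfl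

lemma delta_mul_delta {e f : E} (a : 𝓔.fiber e) (b : 𝓔.fiber f) :
    𝓔.delta e a * 𝓔.delta f b = 𝓔.delta (e ⊓ f) (𝓔.prod e f a b) := by
  simp [sections_mul_def, convolution]

open Classical in
lemma star_delta {e : E} (a : 𝓔.fiber e) :
    star (𝓔.delta e a) = 𝓔.delta e (𝓔.inv e a) :=
  DirectSum.toAddMonoid_of _ e a

lemma sections_star_add (g h : 𝓔.Sections) : star (g + h) = star g + star h :=
  map_add 𝓔.involution g h

lemma sections_star_zero : star (0 : 𝓔.Sections) = 0 := map_zero 𝓔.involution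

variable {𝓔} in
lemma delta_congr {e e' : E} {a : 𝓔.fiber e} {a' : 𝓔.fiber e'}
    (h : (⟨e, a⟩ : Σ e, 𝓔.fiber e) = ⟨e', a'⟩) : 𝓔.delta e a = 𝓔.delta e' a' := by
  cases h; rfl

instance : NonUnitalNonAssocRing 𝓔.Sections where
  __ := (inferInstance : AddCommGroup 𝓔.Sections)
  zero_mul g := by simp [sections_mul_def]
  mul_zero g := by simp [sections_mul_def]
  left_distrib g h k := by simp [sections_mul_def]
  right_distrib g h k := by simp [sections_mul_def]

instance : NonUnitalRing 𝓔.Sections where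
  mul_assoc g h k := by
    induction g using sections_induction with
    | h0 => simp
    | h2 x y hx hy => simp only [add_mul, hx, hy]
    | h1 e a =>
      induction h using sections_induction with
      | h0 => simp
      | h2 x y hx hy => simp only [add_mul, mul_add, hx, hy]
      | h1 f b =>
        induction k using sections_induction with
        | h0 => simp
        | h2 x y hx hy => simp only [mul_add, hx, hy]
        | h1 f b => simp only [delta_mul_delta]; exact delta_congr (𝓔.prod_assoc _ _ _)

instance : StarRing 𝓔.Sections where
  star_involutive g := by
    induction g using sections_induction with
    | h0 => simp [sections_star_zero]
    | h2 x y hx hy => simp only [sections_star_add, hx, hy]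
    | h1 e a => simp only [star_delta, 𝓔.inv_inv]
  star_add := 𝓔.sections_star_add
  star_mul g h := by
    induction g using sections_induction with
    | h0 => simp [sections_star_zero]
    | h2 x y hx hy => simp only [sections_star_add, add_mul, mul_add, hx, hy]
    | h1 e a =>
      induction h using sections_induction with
      | h0 => simp [sections_star_zero]
      | h2 x y hx hy => simp only [sections_star_add, add_mul, mul_add, hx, hy]
      | h1 f b =>
        simp only [star_delta, delta_mul_delta]; exact delta_congr (𝓔.inv_prod _ _)

instance : StarModule ℂ 𝓔.Sections where
  star_smul c g := by
    induction g using sections_induction with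
    | h0 => simp
    | h2 x y hx hy => simp only [smul_add, star_add, hx, hy]
    | h1 e a => rw [← map_smul, star_delta, star_delta, ← map_smul, LinearIsometry.map_smulₛₗ]; rfl

instance : IsScalarTower ℂ 𝓔.Sections 𝓔.Sections :=
  ⟨fun c g h => by simp [sections_mul_def]⟩

instance : SMulCommClass ℂ 𝓔.Sections 𝓔.Sections :=
  ⟨fun c g h => by simp [sections_mul_def]⟩

/-! ### The left regular representation

For a semilattice the Hilbert module of the left regular representation attached to `e` is `A e`
with its standard structure of right Hilbert module over itself, `⟪b, c⟫ = b* c`.  The `C*`-algebra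
of its adjointable operators is Mathlib's algebra of double centralizers of `A e`: an adjointable
operator `T` corresponds to the pair formed by `T` and `b ↦ (T* b*)*`, so that the first component
of a double centralizer is the operator itself, the involution is the passage to the adjoint, and
the norm is the operator norm. -/

/-- The adjointable operators on `A e`. -/
abbrev Adjointable (e : E) : Type v := DoubleCentralizer ℂ (𝓔.fiber e)

lemma adjointable_adjoint {e : E} (T : 𝓔.Adjointable e) (b c : 𝓔.fiber e) :
    star (T.fst b) * c = star b * (star T).fst c := by
  rw [DoubleCentralizer.star_fst, ← star_star c, ← star_mul, ← star_mul, star_star,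
    T.central]

/-- For `e ≤ f`, the action of `a ∈ A f` on `A e` by left (first component) and right (second
component) multiplication. -/
def regularOfLE {e f : E} (h : e ≤ f) (a : 𝓔.fiber f) : 𝓔.Adjointable e where
  fst := LinearMap.mkContinuous
    ((𝓔.transport (inf_eq_right.2 h)).toLinearEquiv.toLinearMap ∘ₗ 𝓔.prod f e a) ‖a‖
    (fun b => by simpa using 𝓔.norm_prod_le a b)
  snd := LinearMap.mkContinuous
    ((𝓔.transport (inf_eq_left.2 h)).toLinearEquiv.toLinearMap ∘ₗ (𝓔.prod e f).flip a) ‖a‖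
    (fun b => by simpa [mul_comm ‖a‖] using 𝓔.norm_prod_le b a)
  central := fun x y => by
    refine sigma_mk_injective (i := e) ?_
    show (⟨e, 𝓔.transport (inf_eq_left.2 h) (𝓔.prod e f x a) * y⟩ : Σ e, 𝓔.fiber e) =
      ⟨e, x * 𝓔.transport (inf_eq_right.2 h) (𝓔.prod f e a y)⟩
    rw [mk_fiber_mul, mk_fiber_mul, mk_prod_congr (mk_transport _ _) rfl, 𝓔.prod_assoc,
      mk_prod_congr rfl (mk_transport _ _)]

variable {𝓔} in
lemma mk_regularOfLE_fst {e f : E} (h : e ≤ f) (a : 𝓔.fiber f) (b : 𝓔.fiber e) :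
    (⟨e, (𝓔.regularOfLE h a).fst b⟩ : Σ e, 𝓔.fiber e) = ⟨_, 𝓔.prod f e a b⟩ :=
  mk_transport _ _

variable {𝓔} in
lemma mk_regularOfLE_snd {e f : E} (h : e ≤ f) (a : 𝓔.fiber f) (b : 𝓔.fiber e) :
    (⟨e, (𝓔.regularOfLE h a).snd b⟩ : Σ e, 𝓔.fiber e) = ⟨_, 𝓔.prod e f b a⟩ :=
  mk_transport _ _

variable {𝓔} in
lemma adjointable_ext {e : E} {S T : 𝓔.Adjointable e}
    (h : ∀ b, (⟨e, S.fst b⟩ : Σ e, 𝓔.fiber e) = ⟨e, T.fst b⟩)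
    (h' : ∀ b, (⟨e, S.snd b⟩ : Σ e, 𝓔.fiber e) = ⟨e, T.snd b⟩) : S = T :=
  DoubleCentralizer.ext ℂ _ _ _ <| Prod.ext
    (ContinuousLinearMap.ext fun b => sigma_mk_injective (h b))
    (ContinuousLinearMap.ext fun b => sigma_mk_injective (h' b))

open Classical in
/-- The operator of `a ∈ A f` on `A e`: left multiplication by `a` if `e ≤ f`, and `0`
otherwise. -/
def regular (e f : E) : 𝓔.fiber f →ₗ[ℂ] 𝓔.Adjointable e where
  toFun a := if h : e ≤ f then 𝓔.regularOfLE h a else 0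
  map_add' a b := by
    split_ifs with h
    · refine DoubleCentralizer.ext ℂ _ _ _ <| Prod.ext (ContinuousLinearMap.ext fun x => ?_)
        (ContinuousLinearMap.ext fun x => ?_) <;> simp [regularOfLE]
    · simp
  map_smul' c a := by
    split_ifs with h
    · refine DoubleCentralizer.ext ℂ _ _ _ <| Prod.ext (ContinuousLinearMap.ext fun x => ?_)
        (ContinuousLinearMap.ext fun x => ?_) <;> simp [regularOfLE]
    · simp

lemma regular_of_le {e f : E} (h : e ≤ f) (a : 𝓔.fiber f) :
    𝓔.regular e f a = 𝓔.regularOfLE h a := dif_pos h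

lemma regular_of_not_le {e f : E} (h : ¬ e ≤ f) (a : 𝓔.fiber f) :
    𝓔.regular e f a = 0 := dif_neg h

lemma regular_prod (e : E) {f g : E} (a : 𝓔.fiber f) (b : 𝓔.fiber g) :
    𝓔.regular e (f ⊓ g) (𝓔.prod f g a b) = 𝓔.regular e f a * 𝓔.regular e g b := by
  by_cases hf : e ≤ f
  · by_cases hg : e ≤ g
    · rw [𝓔.regular_of_le hf, 𝓔.regular_of_le hg, 𝓔.regular_of_le (le_inf hf hg)]
      refine adjointable_ext (fun x => ?_) fun x => ?_
      · rw [mk_regularOfLE_fst, 𝓔.prod_assoc]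
        exact ((mk_regularOfLE_fst hf a _).trans
          (mk_prod_congr rfl (mk_regularOfLE_fst hg b x))).symm
      · rw [mk_regularOfLE_snd, ← 𝓔.prod_assoc]
        exact ((mk_regularOfLE_snd hg b _).trans
          (mk_prod_congr (mk_regularOfLE_snd hf a x) rfl)).symm
    · rw [𝓔.regular_of_not_le hg, 𝓔.regular_of_not_le (fun h => hg (h.trans inf_le_right)),
        mul_zero]
  · rw [𝓔.regular_of_not_le hf, 𝓔.regular_of_not_le (fun h => hf (h.trans inf_le_left)), zero_mul]

lemma regular_inv (e : E) {f : E} (a : 𝓔.fiber f) :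
    𝓔.regular e f (𝓔.inv f a) = star (𝓔.regular e f a) := by
  by_cases hf : e ≤ f
  · rw [𝓔.regular_of_le hf, 𝓔.regular_of_le hf]
    refine adjointable_ext (fun x => ?_) fun x => ?_
    · rw [mk_regularOfLE_fst]
      refine ((mk_inv_congr (mk_regularOfLE_snd hf a (𝓔.inv e x))).trans ?_).symm
      rw [𝓔.inv_prod, 𝓔.inv_inv]
    · rw [mk_regularOfLE_snd]
      refine ((mk_inv_congr (mk_regularOfLE_fst hf a (𝓔.inv e x))).trans ?_).symm
      rw [𝓔.inv_prod, 𝓔.inv_inv]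
  · rw [𝓔.regular_of_not_le hf, 𝓔.regular_of_not_le hf, star_zero]

lemma norm_regular_le (e f : E) (a : 𝓔.fiber f) : ‖𝓔.regular e f a‖ ≤ ‖a‖ := by
  by_cases hf : e ≤ f
  · rw [𝓔.regular_of_le hf, ← DoubleCentralizer.norm_fst]
    refine ContinuousLinearMap.opNorm_le_bound _ (norm_nonneg _) fun x => ?_
    show ‖𝓔.transport (inf_eq_right.2 hf) (𝓔.prod f e a x)‖ ≤ _
    rw [LinearIsometryEquiv.norm_map]
    exact 𝓔.norm_prod_le a x
  · rw [𝓔.regular_of_not_le hf, norm_zero]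
    exact norm_nonneg _

/-- The component at `e` of the left regular representation. -/
def regularAt (e : E) : 𝓔.Sections →⋆ₙₐ[ℂ] 𝓔.Adjointable e where
  toFun := 𝓔.lift (𝓔.regular e)
  map_smul' := map_smul _
  map_zero' := map_zero _
  map_add' := map_add _
  map_mul' g h := by
    induction g using sections_induction with
    | h0 => simp
    | h2 x y hx hy => simp only [add_mul, map_add, hx, hy]
    | h1 f a =>
      induction h using sections_induction with
      | h0 => simp
      | h2 x y hx hy => simp only [mul_add, map_add, hx, hy]
      | h1 k b => simp only [delta_mul_delta, lift_delta, regular_prod]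
  map_star' g := by
    induction g using sections_induction with
    | h0 => simp
    | h2 x y hx hy => simp only [star_add, map_add, hx, hy]
    | h1 f a => simp only [star_delta, lift_delta, regular_inv]

lemma regularAt_delta (e f : E) (a : 𝓔.fiber f) :
    𝓔.regularAt e (𝓔.delta f a) = 𝓔.regular e f a := 𝓔.lift_delta _ _ _

lemma memℓp_regularAt (g : 𝓔.Sections) : Memℓp (fun e => 𝓔.regularAt e g) ∞ := by
  induction g using sections_induction with
  | h0 => simp only [map_zero]; exact zero_memℓp
  | h2 x y hx hy => simp only [map_add]; exact hx.add hy
  | h1 f a =>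
    refine memℓp_infty ⟨‖a‖, ?_⟩
    rintro _ ⟨e, rfl⟩
    simp only [regularAt_delta]
    exact 𝓔.norm_regular_le e f a

/-- The left regular representation, with values in the product of the `C*`-algebras of
adjointable operators (the bounded families, with the supremum norm). -/
def leftRegular : 𝓔.Sections →⋆ₙₐ[ℂ] lp 𝓔.Adjointable ∞ where
  toFun g := ⟨fun e => 𝓔.regularAt e g, 𝓔.memℓp_regularAt g⟩
  map_smul' c g := lp.ext <| funext fun e => map_smul (𝓔.regularAt e) c g
  map_zero' := lp.ext <| funext fun e => map_zero (𝓔.regularAt e)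
  map_add' g h := lp.ext <| funext fun e => map_add (𝓔.regularAt e) g h
  map_mul' g h := lp.ext <| funext fun e => map_mul (𝓔.regularAt e) g h
  map_star' g := lp.ext <| funext fun e => map_star (𝓔.regularAt e) g

/-! ### The full and the reduced algebra -/

/-- The reduced norm `‖g‖_r`, the norm of `g` in the left regular representation. -/
def reducedNorm : CStarSeminorm 𝓔.Sections := CStarSeminorm.ofHom 𝓔.leftRegular

/-- The restriction of a `*`-homomorphism to a fiber of the bundle. -/
def fiberHom {B : Type w} [NonUnitalCStarAlgebra B] (φ : 𝓔.Sections →⋆ₙₐ[ℂ] B) (e : E) :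
    𝓔.fiber e →⋆ₙₐ[ℂ] B where
  toFun a := φ (𝓔.delta e a)
  map_smul' c a := by simp
  map_zero' := by simp
  map_add' a b := by simp
  map_mul' a b := by
    rw [← map_mul, delta_mul_delta]
    exact congrArg φ (delta_congr (𝓔.mk_fiber_mul a b))
  map_star' a := by rw [← map_star, star_delta]; rfl

/-- The norms of the images of `g` under all `*`-homomorphisms into `C*`-algebras.  The
universe of the section algebra is large enough: the closure of the image of a
`*`-homomorphism is a completion of a quotient of the section algebra. -/
def representedNorms (g : 𝓔.Sections) : Set ℝ :=
  {r | ∃ (B : Type (max u v)) (_ : NonUnitalCStarAlgebra B) (φ : 𝓔.Sections →⋆ₙₐ[ℂ] B), r = ‖φ g‖}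

lemma representedNorms_nonempty (g : 𝓔.Sections) : (𝓔.representedNorms g).Nonempty :=
  ⟨_, lp 𝓔.Adjointable ∞, inferInstance, 𝓔.leftRegular, rfl⟩

lemma representedNorms_bddAbove (g : 𝓔.Sections) : BddAbove (𝓔.representedNorms g) := by
  induction g using sections_induction with
  | h0 =>
    refine ⟨0, ?_⟩
    rintro _ ⟨B, _, φ, rfl⟩
    simp
  | h1 e a =>
    refine ⟨‖a‖, ?_⟩
    rintro _ ⟨B, _, φ, rfl⟩
    exact NonUnitalStarAlgHom.norm_apply_le (𝓔.fiberHom φ e) a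
  | h2 x y hx hy =>
    obtain ⟨C, hC⟩ := hx
    obtain ⟨D, hD⟩ := hy
    refine ⟨C + D, ?_⟩
    rintro _ ⟨B, _, φ, rfl⟩
    rw [map_add]
    exact (norm_add_le _ _).trans (add_le_add (hC ⟨B, _, φ, rfl⟩) (hD ⟨B, _, φ, rfl⟩))

variable {𝓔} in
lemma le_sSup_representedNorms {B : Type (max u v)} [NonUnitalCStarAlgebra B]
    (φ : 𝓔.Sections →⋆ₙₐ[ℂ] B) (g : 𝓔.Sections) : ‖φ g‖ ≤ sSup (𝓔.representedNorms g) :=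
  le_csSup (𝓔.representedNorms_bddAbove g) ⟨B, _, φ, rfl⟩

lemma sSup_representedNorms_nonneg (g : 𝓔.Sections) : 0 ≤ sSup (𝓔.representedNorms g) :=
  (norm_nonneg _).trans (le_sSup_representedNorms 𝓔.leftRegular g)

lemma sSup_representedNorms_smul_le (c : ℂ) (g : 𝓔.Sections) :
    sSup (𝓔.representedNorms (c • g)) ≤ ‖c‖ * sSup (𝓔.representedNorms g) := by
  refine csSup_le (𝓔.representedNorms_nonempty _) ?_
  rintro _ ⟨B, _, φ, rfl⟩
  rw [map_smul, norm_smul]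
  exact mul_le_mul_of_nonneg_left (le_sSup_representedNorms φ g) (norm_nonneg c)

/-- The universal norm `‖g‖_u`, the supremum of `‖φ g‖` over all `*`-homomorphisms `φ` from the
section algebra into `C*`-algebras. -/
def fullNorm : CStarSeminorm 𝓔.Sections where
  __ := Seminorm.ofSMulLE (𝕜 := ℂ) (fun g => sSup (𝓔.representedNorms g))
    (le_antisymm (by simpa using 𝓔.sSup_representedNorms_smul_le 0 0)
      (𝓔.sSup_representedNorms_nonneg 0))
    (fun g h => by
      refine csSup_le (𝓔.representedNorms_nonempty _) ?_
      rintro _ ⟨B, _, φ, rfl⟩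
      rw [map_add]
      exact (norm_add_le _ _).trans
        (add_le_add (le_sSup_representedNorms φ g) (le_sSup_representedNorms φ h)))
    𝓔.sSup_representedNorms_smul_le
  mul_le' g h := by
    refine csSup_le (𝓔.representedNorms_nonempty _) ?_
    rintro _ ⟨B, _, φ, rfl⟩
    rw [map_mul]
    exact (norm_mul_le _ _).trans (mul_le_mul (le_sSup_representedNorms φ g)
      (le_sSup_representedNorms φ h) (norm_nonneg _) (𝓔.sSup_representedNorms_nonneg g))
  star_mul_self' g := by
    refine le_antisymm (csSup_le (𝓔.representedNorms_nonempty _) ?_) ?_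
    · rintro _ ⟨B, _, φ, rfl⟩
      rw [map_mul, map_star, CStarRing.norm_star_mul_self, ← sq]
      exact pow_le_pow_left₀ (norm_nonneg _) (le_sSup_representedNorms φ g) 2
    · refine (Real.le_sqrt (𝓔.sSup_representedNorms_nonneg g)
        (𝓔.sSup_representedNorms_nonneg _)).1 (csSup_le (𝓔.representedNorms_nonempty _) ?_)
      rintro _ ⟨B, _, φ, rfl⟩
      refine Real.le_sqrt_of_sq_le ?_
      rw [sq, ← CStarRing.norm_star_mul_self, ← map_star, ← map_mul]
      exact le_sSup_representedNorms φ (star g * g)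

lemma fullNorm_apply (g : 𝓔.Sections) : 𝓔.fullNorm g = sSup (𝓔.representedNorms g) := rfl

lemma reducedNorm_apply (g : 𝓔.Sections) : 𝓔.reducedNorm g = ‖𝓔.leftRegular g‖ := rfl

/-- The full KS-cross sectional `C*`-algebra. -/
abbrev FullKS : Type (max u v) := 𝓔.fullNorm.Completion

/-- The reduced KS-cross sectional `C*`-algebra. -/
abbrev ReducedKS : Type (max u v) := 𝓔.reducedNorm.Completion

end FellBundle

end

/-!
The two norms are compared one finite piece at a time. A section `g` is supported on a finite set
`F ⊆ E`, which may be taken closed under meets; the sections supported on such an `F` form a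
`*`-algebra. On this `*`-algebra the coefficients are controlled by the left regular representation:
the component at `e` of the representation sends `∑ f ∈ F, a f δ_f` to left multiplication by `a e`,
whose norm is `‖a e‖`, plus terms coming from the `f ∈ F` with `e < f`. Descending induction on `e`
thus bounds `‖a e‖` by a multiple of the reduced norm, with a constant depending only on `F` and `e`
(`exists_norm_coeff_le`). A `*`-homomorphism `φ` is contractive on each fiber, so that
`‖φ g‖ ≤ C ‖g‖_r` for all sections `g` supported on `F`
(`exists_norm_apply_le_mul_norm_leftRegular`).

The constant disappears because both sides are `C*`-seminorms: iterating `h ↦ h* h` replaces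
`‖φ g‖` and `‖g‖_r` by their `2 ^ k`-th powers while the constant stays the same
(`CStarSeminorm.le_of_le_mul`). Hence the full and the reduced norm are the same `C*`-seminorm, and
the two completions coincide.
-/

noncomputable section

/-! ### Comparison of `C*`-seminorms -/

namespace CStarSeminorm

variable {A : Type*} [NonUnitalRing A] [StarRing A] [Module ℂ A]

/-- A `C*`-seminorm dominated by a multiple of another one is dominated by it. It suffices to have
the bound on a set that is stable under `h ↦ star h * h`. -/
lemma le_of_le_mul (p q : CStarSeminorm A) {S : Set A} (hS : ∀ h ∈ S, star h * h ∈ S) {C : ℝ}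
    (hC : ∀ h ∈ S, q h ≤ C * p h) {g : A} (hg : g ∈ S) : q g ≤ p g := by
  have key : ∀ k : ℕ, ∃ h ∈ S, q h = q g ^ 2 ^ k ∧ p h = p g ^ 2 ^ k := by
    intro k
    induction k with
    | zero => exact ⟨g, hg, by simp⟩
    | succ k ih =>
      obtain ⟨h, hh, hq, hp⟩ := ih
      refine ⟨star h * h, hS h hh, (q.star_mul_self' h).trans ?_, (p.star_mul_self' h).trans ?_⟩
      · exact (congrArg (· ^ 2) hq).trans (by ring)
      · exact (congrArg (· ^ 2) hp).trans (by ring)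
  by_contra! hlt
  have hp : 0 ≤ p g := apply_nonneg p.toSeminorm g
  rcases hp.eq_or_lt with h0 | hpos
  · have := hC g hg
    rw [← h0, mul_zero] at this
    linarith
  · obtain ⟨n, hn⟩ := pow_unbounded_of_one_lt C ((one_lt_div hpos).2 hlt)
    obtain ⟨h, hh, hq', hp'⟩ := key n
    have h1 : (q g / p g) ^ 2 ^ n ≤ C := by
      rw [div_pow, div_le_iff₀ (pow_pos hpos _), ← hq', ← hp']
      exact hC h hh
    exact absurd (hn.trans_le (pow_le_pow_right₀ ((one_lt_div hpos).2 hlt).le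
      (Nat.lt_two_pow_self (n := n)).le)) (not_lt.2 h1)

lemma ext_apply {p q : CStarSeminorm A} (h : ∀ a, p a = q a) : p = q := by
  cases p
  cases q
  congr
  exact Seminorm.ext h

lemma exists_completion_starAlgEquiv [IsScalarTower ℂ A A] [SMulCommClass ℂ A A] [StarModule ℂ A]
    {p q : CStarSeminorm A} (h : ∀ a, p a = q a) :
    ∃ Ψ : p.Completion ≃⋆ₐ[ℂ] q.Completion, Isometry Ψ ∧
      ∀ a, Ψ (p.toCompletion a) = q.toCompletion a := by
  obtain rfl := ext_apply h
  exact ⟨StarAlgEquiv.refl _ _, isometry_id, fun _ => rfl⟩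

end CStarSeminorm

namespace FellBundle

variable {E : Type u} [SemilatticeInf E] (𝓔 : FellBundle.{u, v} E)

/-! ### Sections with finite prescribed support -/

/-- The sections supported on the finite set `F`, as the range of the map that sends a family `a` to
`∑ e ∈ F, a e δ_e`. -/
def sectionsOn (F : Finset E) : Submodule ℂ 𝓔.Sections :=
  LinearMap.range (∑ e ∈ F, 𝓔.delta e ∘ₗ LinearMap.proj (R := ℂ) (φ := 𝓔.fiber) e)

variable {𝓔}

lemma mem_sectionsOn {F : Finset E} {g : 𝓔.Sections} :
    g ∈ 𝓔.sectionsOn F ↔ ∃ a : ∀ e, 𝓔.fiber e, ∑ e ∈ F, 𝓔.delta e (a e) = g := by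
  simp [sectionsOn, LinearMap.mem_range]

lemma delta_mem_sectionsOn {F : Finset E} {e : E} (he : e ∈ F) (a : 𝓔.fiber e) :
    𝓔.delta e a ∈ 𝓔.sectionsOn F := by
  classical
  refine mem_sectionsOn.2 ⟨Pi.single e a, ?_⟩
  rw [Finset.sum_eq_single e (fun f _ hf => by rw [Pi.single_eq_of_ne hf, map_zero])
    (fun h => absurd he h), Pi.single_eq_same]

lemma sectionsOn_mono {F G : Finset E} (h : F ⊆ G) : 𝓔.sectionsOn F ≤ 𝓔.sectionsOn G := by
  intro g hg
  obtain ⟨a, rfl⟩ := mem_sectionsOn.1 hg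
  exact Submodule.sum_mem _ fun e he => delta_mem_sectionsOn (h he) _

lemma star_mul_self_mem_sectionsOn {F : Finset E} (hF : InfClosed (F : Set E)) {g : 𝓔.Sections}
    (hg : g ∈ 𝓔.sectionsOn F) : star g * g ∈ 𝓔.sectionsOn F := by
  obtain ⟨a, rfl⟩ := mem_sectionsOn.1 hg
  rw [star_sum, Finset.sum_mul_sum]
  refine Submodule.sum_mem _ fun e he => Submodule.sum_mem _ fun f hf => ?_
  rw [star_delta, delta_mul_delta]
  exact delta_mem_sectionsOn (hF he hf) _

variable (𝓔) in
lemma exists_infClosed_mem_sectionsOn (g : 𝓔.Sections) :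
    ∃ F : Finset E, InfClosed (F : Set E) ∧ g ∈ 𝓔.sectionsOn F := by
  classical
  obtain ⟨F, hF⟩ : ∃ F : Finset E, g ∈ 𝓔.sectionsOn F := by
    induction g using sections_induction with
    | h0 => exact ⟨∅, Submodule.zero_mem _⟩
    | h1 e a => exact ⟨{e}, delta_mem_sectionsOn (Finset.mem_singleton_self e) a⟩
    | h2 x y hx hy =>
      obtain ⟨F, hF⟩ := hx
      obtain ⟨G, hG⟩ := hy
      exact ⟨F ∪ G, Submodule.add_mem _ (sectionsOn_mono Finset.subset_union_left hF)
        (sectionsOn_mono Finset.subset_union_right hG)⟩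
  have hfin : (infClosure (F : Set E)).Finite := F.finite_toSet.infClosure
  refine ⟨hfin.toFinset, by simp, sectionsOn_mono (fun e he => ?_) hF⟩
  exact hfin.mem_toFinset.2 (subset_infClosure he)

/-! ### The left regular representation controls the coefficients -/

variable (𝓔) in
/-- Left multiplication in the `C*`-algebra `A e` is isometric. -/
lemma norm_regular_self (e : E) (a : 𝓔.fiber e) : ‖𝓔.regular e e a‖ = ‖a‖ := by
  refine le_antisymm (𝓔.norm_regular_le e e a) ?_
  have h : (𝓔.regular e e a).fst (star a) = a * star a := by
    rw [𝓔.regular_of_le le_rfl]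
    rfl
  have h1 : ‖a‖ * ‖a‖ ≤ ‖𝓔.regular e e a‖ * ‖a‖ := by
    rw [← CStarRing.norm_self_mul_star, ← h, ← DoubleCentralizer.norm_fst]
    simpa using (𝓔.regular e e a).fst.le_opNorm (star a)
  rcases (norm_nonneg a).eq_or_lt with h0 | hpos
  · rw [← h0]; exact norm_nonneg _
  · exact le_of_mul_le_mul_right h1 hpos

variable (𝓔) in
lemma norm_regularAt_le (e : E) (g : 𝓔.Sections) : ‖𝓔.regularAt e g‖ ≤ ‖𝓔.leftRegular g‖ :=
  lp.norm_apply_le_norm ENNReal.top_ne_zero (𝓔.leftRegular g) e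

open Classical in
lemma norm_coeff_le {F : Finset E} {e : E} (he : e ∈ F) (a : ∀ f, 𝓔.fiber f) :
    ‖a e‖ ≤ ‖𝓔.leftRegular (∑ f ∈ F, 𝓔.delta f (a f))‖ +
      ∑ f ∈ F with e < f, ‖a f‖ := by
  have h : 𝓔.regularAt e (∑ f ∈ F, 𝓔.delta f (a f)) =
      𝓔.regular e e (a e) + ∑ f ∈ F with e < f, 𝓔.regular e f (a f) := by
    simp only [map_sum, regularAt_delta]
    rw [← Finset.add_sum_erase F _ he]
    congr 1
    refine (Finset.sum_subset (fun f hf => ?_) fun f hf hf' => ?_).symm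
    · rw [Finset.mem_filter] at hf
      exact Finset.mem_erase.2 ⟨hf.2.ne', hf.1⟩
    · rw [Finset.mem_erase] at hf
      refine 𝓔.regular_of_not_le (fun hle => hf' ?_) _
      exact Finset.mem_filter.2 ⟨hf.2, lt_of_le_of_ne hle (Ne.symm hf.1)⟩
  calc ‖a e‖ = ‖𝓔.regularAt e (∑ f ∈ F, 𝓔.delta f (a f)) -
        ∑ f ∈ F with e < f, 𝓔.regular e f (a f)‖ := by
        rw [h, add_sub_cancel_right, norm_regular_self]
    _ ≤ _ := (norm_sub_le _ _).trans (add_le_add (𝓔.norm_regularAt_le e _)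
        (norm_sum_le_of_le _ fun f _ => 𝓔.norm_regular_le e f (a f)))

variable (𝓔) in
lemma exists_norm_coeff_le (F : Finset E) {e : E} (he : e ∈ F) :
    ∃ C : ℝ, ∀ a : ∀ f, 𝓔.fiber f,
      ‖a e‖ ≤ C * ‖𝓔.leftRegular (∑ f ∈ F, 𝓔.delta f (a f))‖ := by
  classical
  refine (F.finite_toSet.wellFoundedOn (r := (· > ·))).induction he
    (P := fun e => ∃ C : ℝ, ∀ a : ∀ f, 𝓔.fiber f,
      ‖a e‖ ≤ C * ‖𝓔.leftRegular (∑ f ∈ F, 𝓔.delta f (a f))‖) fun e he ih => ?_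
  choose! C hC using ih
  refine ⟨1 + ∑ f ∈ F with e < f, C f, fun a => (norm_coeff_le he a).trans ?_⟩
  rw [add_mul, one_mul, Finset.sum_mul]
  refine add_le_add_right (Finset.sum_le_sum fun f hf => ?_) _
  rw [Finset.mem_filter] at hf
  exact hC f hf.1 hf.2 a

/-! ### Comparison of the norms -/

lemma norm_apply_delta_le {B : Type w} [NonUnitalCStarAlgebra B] (φ : 𝓔.Sections →⋆ₙₐ[ℂ] B)
    (e : E) (a : 𝓔.fiber e) : ‖φ (𝓔.delta e a)‖ ≤ ‖a‖ :=
  NonUnitalStarAlgHom.norm_apply_le (𝓔.fiberHom φ e) a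

lemma exists_norm_apply_le_mul_norm_leftRegular {B : Type w} [NonUnitalCStarAlgebra B]
    (φ : 𝓔.Sections →⋆ₙₐ[ℂ] B) (F : Finset E) :
    ∃ C : ℝ, ∀ g ∈ 𝓔.sectionsOn F, ‖φ g‖ ≤ C * ‖𝓔.leftRegular g‖ := by
  choose! C hC using fun e (he : e ∈ F) => 𝓔.exists_norm_coeff_le F he
  refine ⟨∑ e ∈ F, C e, fun g hg => ?_⟩
  obtain ⟨a, rfl⟩ := mem_sectionsOn.1 hg
  rw [Finset.sum_mul, map_sum φ]
  exact norm_sum_le_of_le _ fun e he => (norm_apply_delta_le φ e (a e)).trans (hC e he a)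

theorem norm_apply_le_norm_leftRegular {B : Type w} [NonUnitalCStarAlgebra B]
    (φ : 𝓔.Sections →⋆ₙₐ[ℂ] B) (g : 𝓔.Sections) : ‖φ g‖ ≤ ‖𝓔.leftRegular g‖ := by
  obtain ⟨F, hF, hg⟩ := 𝓔.exists_infClosed_mem_sectionsOn g
  obtain ⟨C, hC⟩ := exists_norm_apply_le_mul_norm_leftRegular φ F
  exact CStarSeminorm.le_of_le_mul 𝓔.reducedNorm (CStarSeminorm.ofHom φ)
    (S := 𝓔.sectionsOn F) (fun _ => star_mul_self_mem_sectionsOn hF) hC hg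

variable (𝓔) in
theorem reducedNorm_eq_fullNorm (g : 𝓔.Sections) : 𝓔.reducedNorm g = 𝓔.fullNorm g := by
  rw [reducedNorm_apply, fullNorm_apply]
  refine le_antisymm (le_sSup_representedNorms 𝓔.leftRegular g)
    (csSup_le (𝓔.representedNorms_nonempty g) ?_)
  rintro _ ⟨B, _, φ, rfl⟩
  exact norm_apply_le_norm_leftRegular φ g

end FellBundle

end

theorem proposition5p2 {E : Type u} [SemilatticeInf E] (𝓔 : FellBundle.{u, v} E) :
    (∀ g : 𝓔.Sections, 𝓔.reducedNorm g = 𝓔.fullNorm g) ∧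
    (∀ (B : Type w) [NonUnitalCStarAlgebra B] (φ : 𝓔.Sections →⋆ₙₐ[ℂ] B) (g : 𝓔.Sections),
      ‖φ g‖ ≤ ‖𝓔.leftRegular g‖) ∧
    ∃ Ψ : 𝓔.FullKS ≃⋆ₐ[ℂ] 𝓔.ReducedKS, Isometry Ψ ∧
      ∀ g : 𝓔.Sections, Ψ (𝓔.fullNorm.toCompletion g) = 𝓔.reducedNorm.toCompletion g :=
  ⟨𝓔.reducedNorm_eq_fullNorm, fun _ _ φ g => FellBundle.norm_apply_le_norm_leftRegular φ g,
    CStarSeminorm.exists_completion_starAlgEquiv fun g => (𝓔.reducedNorm_eq_fullNorm g).symm⟩
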